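/- Let $K$ be a field of characteristic zero (for example $K=\mathbb{Q}$). For a matroid $M$ on a finite set $E$ with rank function $r_M$, let \[ T(M;x,y)=\sum_{A\subseteq E}(x-1)^{r_M(E)-r_M(A)}(y-1)^{|A|-r_M(A)}\in K[x,y] \] be its Tutte polynomial. For a length-$n$ $(0,1)$-sequence $\underline{s}=(s_1,\dots,s_n)$, the freedom matroid $F(\underline{s})$ is the matroid on $\{1,\dots,n\}$ obtained from the empty matroid by adding the elements $1,2,\dots,n$ in this order, where $i$ is added as an isthmus (coloop) if $s_i=1$, and $i$ is added freely positioned in the closure of $\{1,\dots,i-1\}$ (that is, by free extension; in particular as a loop if the current rank is $0$) if $s_i=0$. Let $M$ be a matroid of rank $r$ on a finite set of $n$ elements. Then $T(M;x,y)$ is a linear combination, with coefficients in $K$, of the Tutte polynomials $T(F(\underline{s});x,y)$, where $\underline{s}$ ranges over all length-$n$ $(0,1)$-sequences with exactly $r$ ones. -/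

import Mathlib

/-- The Tutte polynomial of a matroid with finite ground set `E`,
`T(M; x, y) = ∑_{A ⊆ E} (x - 1) ^ (r(E) - r(A)) * (y - 1) ^ (|A| - r(A))`,
as a polynomial in `x = X 0` and `y = X 1` with coefficients in `K`. -/
noncomputable def tuttePolynomial (K : Type*) [CommRing K] {α : Type*} (M : Matroid α) [M.Finite] :
    MvPolynomial (Fin 2) K :=
  ∑ A ∈ M.ground_finite.toFinset.powerset,
    (MvPolynomial.X 0 - 1) ^ ((M.eRk M.E).toNat - (M.eRk (A : Set α)).toNat) *
      (MvPolynomial.X 1 - 1) ^ (A.card - (M.eRk (A : Set α)).toNat)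

lemma Matroid.indep_isBase_of_ncard_le {α : Type*} {M : Matroid α} [M.Finite] {B I : Set α}
    (hB : M.IsBase B) (hI : M.Indep I) (h : B.ncard ≤ I.ncard) : M.IsBase I := by
  obtain ⟨B', hB', hIB'⟩ := hI.exists_isBase_superset
  have hfin : B'.Finite := M.ground_finite.subset hB'.subset_ground
  rw [hB.ncard_eq_ncard_of_isBase hB'] at h
  rwa [Set.eq_of_subset_of_ncard_le hIB' h hfin]

lemma Matroid.indep_augment_ncard {α : Type*} {M : Matroid α} [M.Finite] {I J : Set α}
    (hI : M.Indep I) (hJ : M.Indep J) (h : I.ncard < J.ncard) :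
    ∃ x ∈ J, x ∉ I ∧ M.Indep (insert x I) := by
  obtain ⟨x, hx, hxI⟩ := hI.augment hJ (by
    rw [← (M.ground_finite.subset hI.subset_ground).cast_ncard_eq,
      ← (M.ground_finite.subset hJ.subset_ground).cast_ncard_eq]
    exact_mod_cast h)
  exact ⟨x, hx.1, hx.2, hxI⟩

/-- The matroid obtained from `M` by adding a new element `e ∉ M.E` as an isthmus (coloop):
a set `I` is independent if and only if `I - e` is independent in `M`. -/
def Matroid.addIsthmus {α : Type*} (M : Matroid α) [M.Finite] (e : α) : Matroid α :=
  (IndepMatroid.ofFinite (E := insert e M.E) (M.ground_finite.insert e)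
    (fun I ↦ M.Indep (I \ {e}))
    (by simp)
    (fun I J hJ hIJ ↦ hJ.subset (Set.sdiff_subset_sdiff_left hIJ))
    (by
      intro I J hI hJ hIJ
      have hIfin : I.Finite := by
        refine (M.ground_finite.insert e).subset ?_
        rw [← Set.sdiff_singleton_subset_iff]
        exact hI.subset_ground
      have hJfin : J.Finite := by
        refine (M.ground_finite.insert e).subset ?_
        rw [← Set.sdiff_singleton_subset_iff]
        exact hJ.subset_ground
      by_cases h : e ∈ J ∧ e ∉ I
      · exact ⟨e, h.1, h.2, by simpa using hI⟩
      have hlt : (I \ {e}).ncard < (J \ {e}).ncard := by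
        by_cases heI : e ∈ I
        · have h1 := Set.ncard_sdiff_singleton_add_one heI hIfin
          have h2 := Set.pred_ncard_le_ncard_sdiff_singleton J e
          omega
        · have heJ : e ∉ J := fun h' ↦ h ⟨h', heI⟩
          rwa [Set.sdiff_singleton_eq_self heI, Set.sdiff_singleton_eq_self heJ]
      obtain ⟨x, hx, hxI, hind⟩ := Matroid.indep_augment_ncard hI hJ hlt
      refine ⟨x, hx.1, fun h' ↦ hxI ⟨h', hx.2⟩, ?_⟩
      rwa [Set.insert_sdiff_of_notMem _ hx.2])
    (fun I hI ↦ by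
      rw [← Set.sdiff_singleton_subset_iff]
      exact hI.subset_ground)).matroid

/-- The free extension of `M` by a new element `e ∉ M.E`, that is, `e` is freely positioned in the
closure of the ground set of `M`: the independent sets are the independent sets of `M` and the sets
`I ∪ {e}` where `I` is an independent set of `M` that is not a base. If `M` has rank `0`,
then `e` is a loop. -/
def Matroid.freeExtension {α : Type*} (M : Matroid α) [M.Finite] (e : α) : Matroid α :=
  (IndepMatroid.ofFinite (E := insert e M.E) (M.ground_finite.insert e)
    (fun I ↦ M.Indep (I \ {e}) ∧ (e ∈ I → ¬ M.IsBase (I \ {e})))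
    (by simp)
    (fun I J hJ hIJ ↦ by
      have hsub : I \ {e} ⊆ J \ {e} := Set.sdiff_subset_sdiff_left hIJ
      refine ⟨hJ.1.subset hsub, fun heI hB ↦ hJ.2 (hIJ heI) ?_⟩
      rwa [← hB.eq_of_subset_indep hJ.1 hsub])
    (by
      rintro I J ⟨hI, hIe⟩ ⟨hJ, hJe⟩ hIJ
      have hIfin : I.Finite := by
        refine (M.ground_finite.insert e).subset ?_
        rw [← Set.sdiff_singleton_subset_iff]
        exact hI.subset_ground
      have hJfin : J.Finite := by
        refine (M.ground_finite.insert e).subset ?_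
        rw [← Set.sdiff_singleton_subset_iff]
        exact hJ.subset_ground
      have hI'fin : (I \ {e}).Finite := hIfin.subset Set.sdiff_subset
      have hJB : ∀ B, M.IsBase B → J.ncard ≤ B.ncard := by
        intro B hB
        by_contra! hlt
        by_cases heJ : e ∈ J
        · have h1 := Set.ncard_sdiff_singleton_add_one heJ hJfin
          exact hJe heJ (Matroid.indep_isBase_of_ncard_le hB hJ (by omega))
        · rw [Set.sdiff_singleton_eq_self heJ] at hJ
          obtain ⟨x, -, hx, hx'⟩ := Matroid.indep_augment_ncard hB.indep hJ hlt
          exact hx (hB.mem_of_insert_indep hx')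
      by_cases h : e ∈ J ∧ e ∉ I
      · refine ⟨e, h.1, h.2, by simpa using hI, fun _ hB ↦ ?_⟩
        have := hJB _ hB
        rw [Set.insert_sdiff_self_of_notMem h.2] at this
        omega
      have hlt : (I \ {e}).ncard < (J \ {e}).ncard := by
        by_cases heI : e ∈ I
        · have h1 := Set.ncard_sdiff_singleton_add_one heI hIfin
          have h2 := Set.pred_ncard_le_ncard_sdiff_singleton J e
          omega
        · have heJ : e ∉ J := fun h' ↦ h ⟨h', heI⟩
          rwa [Set.sdiff_singleton_eq_self heI, Set.sdiff_singleton_eq_self heJ]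
      obtain ⟨x, hx, hxI, hind⟩ := Matroid.indep_augment_ncard hI hJ hlt
      refine ⟨x, hx.1, fun h' ↦ hxI ⟨h', hx.2⟩, ?_⟩
      rw [Set.insert_sdiff_of_notMem _ hx.2]
      refine ⟨hind, fun he hB ↦ ?_⟩
      have heI : e ∈ I := he.resolve_left fun h' ↦ hx.2 h'.symm
      have h1 := Set.ncard_sdiff_singleton_add_one heI hIfin
      have h2 := Set.ncard_insert_of_notMem hxI hI'fin
      have h3 := hJB _ hB
      omega)
    (fun I hI ↦ by
      rw [← Set.sdiff_singleton_subset_iff]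
      exact hI.1.subset_ground)).matroid

/-- The matroid on the first `k` elements of `Fin n` built from the `(0,1)`-sequence `s`: elements
are added one at a time in increasing order, an element in a position with a `1` as an isthmus,
and an element in a position with a `0` freely positioned in the closure of the elements present. -/
def freedomMatroidAux {n : ℕ} (s : Fin n → Fin 2) : ℕ → Matroid (Fin n)
  | 0 => Matroid.emptyOn (Fin n)
  | k + 1 =>
    if h : k < n then
      if s ⟨k, h⟩ = 1 then (freedomMatroidAux s k).addIsthmus ⟨k, h⟩
      else (freedomMatroidAux s k).freeExtension ⟨k, h⟩
    else freedomMatroidAux s k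

/-- The freedom matroid `F(s)` on `n` elements defined by the length-`n` `(0,1)`-sequence `s`. -/
def freedomMatroid {n : ℕ} (s : Fin n → Fin 2) : Matroid (Fin n) :=
  freedomMatroidAux s n

/-! Refine the sum over subsets to a sum over maximal chains. Each `A` is an initial segment of
|A|!(n-|A|)! orderings of the ground set, so in characteristic zero its term can be shared equally
among them. Along one ordering the rank rises by 0 or 1 at each step. The rises form a
(0,1)-sequence with `r` ones, and the ordering's share of the Tutte polynomial depends only on this
sequence (`tuttePolynomial_eq_sum_rankSequence`).

It remains to put each share `sequenceTutte K s` in the span of the Tutte polynomials of freedom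
matroids. In F(s) every `m`-set has rank at least the number of ones among the first `m` entries of
`s` (`onesBelow_card_le_pulledRank`), with equality for the first `m` elements. Hence the rank
sequences of F(s) all dominate `s`, and `s` itself occurs. The system is triangular with positive
integer diagonal, and `sequenceTutte_mem_span` inverts it. -/

/-! ### Counting ones in (0,1)-sequences -/

/-- The number of ones among the first `m` entries of the `(0,1)`-sequence `s`. -/
def onesBelow {n : ℕ} (s : Fin n → Fin 2) (m : ℕ) : ℕ :=
  (Finset.univ.filter fun i : Fin n ↦ i.val < m ∧ s i = 1).card

lemma onesBelow_zero {n : ℕ} (s : Fin n → Fin 2) : onesBelow s 0 = 0 := by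
  simp [onesBelow]

lemma onesBelow_succ {n : ℕ} (s : Fin n → Fin 2) {m : ℕ} (h : m < n) :
    onesBelow s (m + 1) = onesBelow s m + if s ⟨m, h⟩ = 1 then 1 else 0 := by
  unfold onesBelow
  split_ifs with hs
  · rw [← Finset.card_insert_of_notMem (a := (⟨m, h⟩ : Fin n)) (by simp)]
    congr 1
    ext i
    simp only [Finset.mem_filter, Finset.mem_univ, true_and, Finset.mem_insert]
    constructor
    · rintro ⟨h1, h2⟩
      by_cases hi : i.val = m
      · exact Or.inl (Fin.ext hi)
      · exact Or.inr ⟨by omega, h2⟩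
    · rintro (h1 | h1)
      · subst h1
        exact ⟨by simp, hs⟩
      · exact ⟨by omega, h1.2⟩
  · rw [add_zero]
    congr 1
    ext i
    simp only [Finset.mem_filter, Finset.mem_univ, true_and]
    refine and_congr_left fun hi ↦ ⟨fun h1 ↦ ?_, fun h1 ↦ by omega⟩
    refine lt_of_le_of_ne (by omega) ?_
    rintro rfl
    exact hs hi

lemma onesBelow_length {n : ℕ} (s : Fin n → Fin 2) :
    onesBelow s n = (Finset.univ.filter fun i ↦ s i = 1).card := by
  simp [onesBelow]

lemma onesBelow_injective {n : ℕ} {s t : Fin n → Fin 2}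
    (h : ∀ m ≤ n, onesBelow s m = onesBelow t m) : s = t := by
  funext i
  have h1 := h (i + 1) i.isLt
  rw [onesBelow_succ s i.isLt, onesBelow_succ t i.isLt, h i i.isLt.le, add_right_inj] at h1
  simp only [Fin.eta] at h1
  have key : ∀ a b : Fin 2, ((if a = 1 then 1 else 0 : ℕ) = if b = 1 then 1 else 0) → a = b := by
    decide
  exact key _ _ h1

/-! ### Independent sets of freedom matroids -/

lemma Matroid.addIsthmus_indep_iff {α : Type*} (M : Matroid α) [M.Finite] (e : α) (I : Set α) :
    (M.addIsthmus e).Indep I ↔ M.Indep (I \ {e}) := Iff.rfl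

lemma Matroid.freeExtension_indep_iff {α : Type*} (M : Matroid α) [M.Finite] (e : α) (I : Set α) :
    (M.freeExtension e).Indep I ↔ M.Indep (I \ {e}) ∧ (e ∈ I → ¬ M.IsBase (I \ {e})) := Iff.rfl

/-- A finite matroid whose independent sets have at most `k` elements, with equality attained:
the bases are the independent sets of size `k`. -/
lemma Matroid.isBase_iff_of_ncard_le {α : Type*} {M : Matroid α} [M.Finite] {k : ℕ}
    (hle : ∀ I, M.Indep I → I.ncard ≤ k) (hex : ∃ J, M.Indep J ∧ J.ncard = k) {I : Set α}
    (hI : M.Indep I) : M.IsBase I ↔ I.ncard = k := by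
  obtain ⟨J, hJ, hJk⟩ := hex
  constructor
  · intro hB
    refine le_antisymm (hle I hI) ?_
    by_contra! hlt
    obtain ⟨x, -, hx, hx'⟩ := Matroid.indep_augment_ncard hI hJ (by omega)
    exact hx (hB.mem_of_insert_indep hx')
  · intro hIk
    obtain ⟨B, hB⟩ := M.exists_isBase
    exact Matroid.indep_isBase_of_ncard_le hB hI (hIk ▸ hle B hB.indep)

lemma card_filter_val_lt_erase {n k : ℕ} (h : k < n) (I : Finset (Fin n)) {m : ℕ} (hm : m ≤ k) :
    ((I.erase ⟨k, h⟩).filter fun i ↦ i.val < m).card = (I.filter fun i ↦ i.val < m).card := by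
  congr 1
  ext i
  simp only [Finset.mem_filter, Finset.mem_erase, Ne, Fin.ext_iff]
  constructor
  · rintro ⟨⟨-, h1⟩, h2⟩
    exact ⟨h1, h2⟩
  · rintro ⟨h1, h2⟩
    exact ⟨⟨by omega, h1⟩, h2⟩

/-- A set is independent in the matroid built from the first `k` entries of `s` if and only if each
initial segment `{0, …, m - 1}` meets it in at most as many elements as `s` has ones there. -/
lemma freedomMatroidAux_indep_iff {n : ℕ} (s : Fin n → Fin 2) {k : ℕ} (hk : k ≤ n)
    (I : Finset (Fin n)) :
    (freedomMatroidAux s k).Indep (I : Set (Fin n)) ↔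
      (∀ i ∈ I, i.val < k) ∧ ∀ m ≤ k, (I.filter fun i ↦ i.val < m).card ≤ onesBelow s m := by
  induction k generalizing I with
  | zero =>
    simp only [freedomMatroidAux, Matroid.emptyOn_indep_iff, Finset.coe_eq_empty]
    constructor
    · rintro rfl
      simp
    · rintro ⟨h, -⟩
      exact Finset.eq_empty_of_forall_notMem fun i hi ↦ absurd (h i hi) (Nat.not_lt_zero _)
  | succ k ih =>
    have hkn : k < n := hk
    have ih' := ih hkn.le
    have hall : ∀ J : Finset (Fin n), (∀ i ∈ J, i.val < k) →
        (J.filter fun i ↦ i.val < k).card = J.card := fun J hJ ↦ by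
      rw [Finset.filter_true_of_mem hJ]
    have hcard : (I.filter fun i ↦ i.val < k + 1).card =
        (I.filter fun i ↦ i.val < k).card + if (⟨k, hkn⟩ : Fin n) ∈ I then 1 else 0 := by
      split_ifs with hmem
      · rw [← Finset.card_insert_of_notMem (a := (⟨k, hkn⟩ : Fin n)) (by simp)]
        congr 1
        ext i
        simp only [Finset.mem_filter, Finset.mem_insert, Fin.ext_iff]
        constructor
        · rintro ⟨h1, h2⟩
          by_cases hi : i.val = k
          · exact Or.inl hi
          · exact Or.inr ⟨h1, by omega⟩
        · rintro (h1 | h1)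
          · obtain rfl : i = ⟨k, hkn⟩ := Fin.ext h1
            exact ⟨hmem, by simp⟩
          · exact ⟨h1.1, by omega⟩
      · rw [add_zero]
        congr 1
        ext i
        simp only [Finset.mem_filter]
        refine and_congr_right fun hi ↦ ⟨fun h1 ↦ ?_, fun h1 ↦ by omega⟩
        refine lt_of_le_of_ne (by omega) ?_
        rintro rfl
        exact hmem hi
    have hlt : (∀ i ∈ I.erase ⟨k, hkn⟩, i.val < k) ↔ ∀ i ∈ I, i.val < k + 1 := by
      simp only [Finset.mem_erase, Ne, Fin.ext_iff, and_imp]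
      constructor
      · intro h i hi
        by_cases hik : i.val = k
        · omega
        · have := h i hik hi
          omega
      · intro h i hik hi
        have := h i hi
        omega
    have hle : ∀ P : ℕ → Prop, (∀ m ≤ k + 1, P m) ↔ (∀ m ≤ k, P m) ∧ P (k + 1) := fun P ↦
      ⟨fun h ↦ ⟨fun m hm ↦ h m (by omega), h _ le_rfl⟩, fun h m hm ↦ by
        rcases Nat.lt_or_ge k m with h1 | h1
        · obtain rfl : m = k + 1 := by omega
          exact h.2
        · exact h.1 m h1⟩
    have herase : (freedomMatroidAux s k).Indep ((I : Set (Fin n)) \ {⟨k, hkn⟩}) ↔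
        (∀ i ∈ I, i.val < k + 1) ∧
          ∀ m ≤ k, (I.filter fun i ↦ i.val < m).card ≤ onesBelow s m := by
      rw [← Finset.coe_erase, ih', hlt]
      refine and_congr_right fun _ ↦ forall₂_congr fun m hm ↦ ?_
      rw [card_filter_val_lt_erase hkn I hm]
    rw [hle, hcard, onesBelow_succ s hkn, freedomMatroidAux, dif_pos hkn]
    split_ifs with hs hmem hmem
    · rw [Matroid.addIsthmus_indep_iff, herase]
      refine and_congr_right fun _ ↦ ⟨fun h ↦ ⟨h, ?_⟩, fun h ↦ h.1⟩
      simpa using h k le_rfl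
    · rw [Matroid.addIsthmus_indep_iff, herase]
      refine and_congr_right fun _ ↦ ⟨fun h ↦ ⟨h, ?_⟩, fun h ↦ h.1⟩
      have := h k le_rfl
      omega
    -- The bound at `m = k` limits independent sets to `onesBelow s k` elements, and the positions
    -- of the ones before `k` attain it. Not being a base thus means strict inequality, which is the
    -- condition at `k + 1` when the new element is in `I`.
    · have hbase : ∀ J, (freedomMatroidAux s k).Indep J →
          ((freedomMatroidAux s k).IsBase J ↔ J.ncard = onesBelow s k) := by
        intro J hJ
        refine Matroid.isBase_iff_of_ncard_le ?_ ?_ hJ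
        · intro I' hI'
          lift I' to Finset (Fin n) using Set.toFinite I'
          rw [ih'] at hI'
          rw [Set.ncard_coe_finset, ← hall I' hI'.1]
          exact hI'.2 k le_rfl
        · refine ⟨((Finset.univ.filter fun i : Fin n ↦ i.val < k ∧ s i = 1 : Finset (Fin n)) :
            Set (Fin n)), ?_, by rw [Set.ncard_coe_finset]; rfl⟩
          rw [ih']
          refine ⟨fun i hi ↦ (Finset.mem_filter.1 hi).2.1, fun m hm ↦ Finset.card_le_card fun i hi ↦ ?_⟩
          simp only [Finset.mem_filter, Finset.mem_univ, true_and] at hi ⊢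
          exact ⟨hi.2, hi.1.2⟩
      rw [Matroid.freeExtension_indep_iff]
      have hmem' : (⟨k, hkn⟩ : Fin n) ∈ (I : Set (Fin n)) := hmem
      simp only [hmem', forall_const]
      constructor
      · rintro ⟨h1, h2⟩
        rw [hbase _ h1] at h2
        have h3 := herase.1 h1
        refine ⟨h3.1, h3.2, ?_⟩
        rw [← Finset.coe_erase, Set.ncard_coe_finset, ← hall _ (hlt.2 h3.1),
          card_filter_val_lt_erase hkn I le_rfl] at h2
        have := h3.2 k le_rfl
        omega
      · rintro ⟨h1, h2, h3⟩
        have h4 := herase.2 ⟨h1, h2⟩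
        refine ⟨h4, ?_⟩
        rw [hbase _ h4, ← Finset.coe_erase, Set.ncard_coe_finset, ← hall _ (hlt.2 h1),
          card_filter_val_lt_erase hkn I le_rfl]
        omega
    · rw [Matroid.freeExtension_indep_iff, herase]
      have hmem' : (⟨k, hkn⟩ : Fin n) ∉ (I : Set (Fin n)) := hmem
      simp only [hmem', false_imp_iff, and_true, add_zero]
      refine and_congr_right fun _ ↦ ⟨fun h ↦ ⟨h, h k le_rfl⟩, fun h ↦ h.1⟩

lemma freedomMatroid_indep_iff {n : ℕ} (s : Fin n → Fin 2) (I : Finset (Fin n)) :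
    (freedomMatroid s).Indep (I : Set (Fin n)) ↔
      ∀ m ≤ n, (I.filter fun i ↦ i.val < m).card ≤ onesBelow s m := by
  rw [freedomMatroid, freedomMatroidAux_indep_iff s le_rfl]
  exact and_iff_right fun i _ ↦ i.isLt

lemma freedomMatroid_ground {n : ℕ} (s : Fin n → Fin 2) :
    (freedomMatroid s).E = Set.univ := by
  have key : ∀ k ≤ n, (freedomMatroidAux s k).E = {i | i.val < k} := by
    intro k hk
    induction k with
    | zero => simp [freedomMatroidAux]
    | succ k ih =>
      have hkn : k < n := hk
      have hE : (freedomMatroidAux s (k + 1)).E =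
          insert ⟨k, hkn⟩ (freedomMatroidAux s k).E := by
        rw [freedomMatroidAux, dif_pos hkn]
        split_ifs <;> rfl
      rw [hE, ih hkn.le]
      ext i
      simp only [Set.mem_insert_iff, Set.mem_ofPred_eq, Fin.ext_iff]
      omega
  rw [freedomMatroid, key n le_rfl]
  ext i
  simp

/-! ### Ranks of finite sets and rank bounds in freedom matroids -/

/-- The rank function of a matroid, pulled back along `f` to finite sets. -/
noncomputable def pulledRank {α : Type*} {n : ℕ} (M : Matroid α) (f : Fin n → α)
    (A : Finset (Fin n)) : ℕ :=
  (M.eRk (f '' (A : Set (Fin n)))).toNat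

lemma eRk_image_ne_top {α : Type*} {n : ℕ} (M : Matroid α) (f : Fin n → α)
    (A : Finset (Fin n)) : M.eRk (f '' (A : Set (Fin n))) ≠ ⊤ :=
  ne_top_of_le_ne_top (Set.encard_ne_top_iff.2 (A.finite_toSet.image f)) (M.eRk_le_encard _)

lemma pulledRank_empty {α : Type*} {n : ℕ} (M : Matroid α) (f : Fin n → α) :
    pulledRank M f ∅ = 0 := by
  simp [pulledRank]

lemma pulledRank_mono {α : Type*} {n : ℕ} (M : Matroid α) (f : Fin n → α) :
    Monotone (pulledRank M f) := fun A B h ↦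
  ENat.toNat_le_toNat (M.eRk_mono (Set.image_mono (by exact_mod_cast h))) (eRk_image_ne_top M f B)

lemma pulledRank_insert_le {α : Type*} {n : ℕ} (M : Matroid α) (f : Fin n → α) (a : Fin n)
    (A : Finset (Fin n)) : pulledRank M f (insert a A) ≤ pulledRank M f A + 1 := by
  have h : M.eRk (f '' ((insert a A : Finset (Fin n)) : Set (Fin n))) ≤
      M.eRk (f '' (A : Set (Fin n))) + 1 := by
    rw [Finset.coe_insert, Set.image_insert_eq]
    exact M.eRk_insert_le_add_one _ _
  rw [← ENat.natCast_toNat (eRk_image_ne_top M f (insert a A)),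
    ← ENat.natCast_toNat (eRk_image_ne_top M f A)] at h
  exact_mod_cast h

/-- Copy the ones among the first |A| positions into `A` by its increasing enumeration `g`. Since `g
j ≥ j`, elements only move to the right, so no initial segment gains any, and the copy is
independent. -/
lemma onesBelow_card_le_pulledRank {n : ℕ} (s : Fin n → Fin 2) (A : Finset (Fin n)) :
    onesBelow s A.card ≤ pulledRank (freedomMatroid s) id A := by
  have hA : A.card ≤ n := by simpa using A.card_le_univ
  let g := A.orderEmbOfFin rfl
  have hg : ∀ j, j.val ≤ (g j).val := by
    rintro ⟨j, hj⟩
    induction j with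
    | zero => exact Nat.zero_le _
    | succ j ih =>
      have h1 := ih (by omega)
      have h2 : g ⟨j, by omega⟩ < g ⟨j + 1, hj⟩ := g.strictMono (by simp [Fin.lt_def])
      rw [Fin.lt_def] at h2
      simp only at h1 ⊢
      omega
  let J : Finset (Fin A.card) := Finset.univ.filter fun j ↦ s (Fin.castLE hA j) = 1
  have hJ : ∀ m ≤ n, (J.filter fun j ↦ j.val < m).card ≤ onesBelow s m := by
    intro m _
    refine Finset.card_le_card_of_injOn (Fin.castLE hA) ?_ (Fin.castLE_injective hA).injOn
    intro j hj
    simp only [J, Finset.coe_filter, Finset.mem_filter, Finset.mem_univ, true_and,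
      Set.mem_ofPred_eq] at hj ⊢
    exact ⟨hj.2, hj.1⟩
  have hJcard : onesBelow s A.card = J.card := by
    symm
    refine Finset.card_bij (fun j _ ↦ Fin.castLE hA j) ?_ ?_ ?_
    · intro j hj
      simp only [J, Finset.mem_filter, Finset.mem_univ, true_and] at hj ⊢
      exact ⟨j.isLt, hj⟩
    · intro i _ j _ hij
      exact Fin.castLE_injective hA hij
    · intro i hi
      simp only [Finset.mem_filter, Finset.mem_univ, true_and] at hi
      refine ⟨⟨i, hi.1⟩, ?_, by ext; rfl⟩
      simp only [J, Finset.mem_filter, Finset.mem_univ, true_and]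
      exact hi.2
  have hind : (freedomMatroid s).Indep ((J.map g.toEmbedding : Finset (Fin n)) : Set (Fin n)) := by
    rw [freedomMatroid_indep_iff]
    intro m hm
    refine le_trans ?_ (hJ m hm)
    rw [Finset.filter_map, Finset.card_map]
    refine Finset.card_le_card fun j hj ↦ ?_
    simp only [Finset.mem_filter, Function.comp_apply] at hj ⊢
    exact ⟨hj.1, (hg j).trans_lt hj.2⟩
  have hsub : ((J.map g.toEmbedding : Finset (Fin n)) : Set (Fin n)) ⊆ id '' (A : Set (Fin n)) := by
    intro x hx
    simp only [Finset.coe_map, Set.mem_image] at hx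
    obtain ⟨j, -, rfl⟩ := hx
    exact ⟨_, A.orderEmbOfFin_mem rfl j, rfl⟩
  have h := hind.encard_le_eRk_of_subset hsub
  rw [Set.encard_coe_eq_coe_finsetCard, Finset.card_map, ← hJcard,
    ← ENat.natCast_toNat (eRk_image_ne_top _ _ A)] at h
  exact Nat.cast_le.1 h

/-- A basis of `A` lies wholly within the first `m` elements, so the independence bound at `m`
limits its size. -/
lemma pulledRank_freedomMatroid_le {n : ℕ} (s : Fin n → Fin 2) {A : Finset (Fin n)} {m : ℕ}
    (hm : m ≤ n) (hA : ∀ i ∈ A, i.val < m) :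
    pulledRank (freedomMatroid s) id A ≤ onesBelow s m := by
  obtain ⟨I, hI⟩ := (freedomMatroid s).exists_isBasis' (id '' (A : Set (Fin n)))
  have hsub := hI.subset
  have hind := hI.indep
  unfold pulledRank
  rw [← hI.encard_eq_eRk]
  lift I to Finset (Fin n) using Set.toFinite I
  rw [freedomMatroid_indep_iff] at hind
  rw [Set.encard_coe_eq_coe_finsetCard, ENat.toNat_natCast]
  refine le_trans (le_of_eq ?_) (hind m hm)
  rw [Finset.filter_true_of_mem]
  intro i hi
  exact hA i (by simpa using hsub hi)

/-! ### Initial segments of orderings -/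

/-- The set of the first `m` elements of `Fin n` in the ordering given by the permutation `σ`. -/
def prefixSet {n : ℕ} (σ : Equiv.Perm (Fin n)) (m : ℕ) : Finset (Fin n) :=
  (Finset.univ.filter fun i : Fin n ↦ i.val < m).map σ.toEmbedding

lemma card_prefixSet {n : ℕ} (σ : Equiv.Perm (Fin n)) {m : ℕ} (hm : m ≤ n) :
    (prefixSet σ m).card = m := by
  rw [prefixSet, Finset.card_map, Fin.card_filter_val_lt, min_eq_right hm]

lemma prefixSet_zero {n : ℕ} (σ : Equiv.Perm (Fin n)) : prefixSet σ 0 = ∅ := by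
  simp [prefixSet]

lemma prefixSet_length {n : ℕ} (σ : Equiv.Perm (Fin n)) : prefixSet σ n = Finset.univ := by
  simp [prefixSet]

lemma prefixSet_succ {n : ℕ} (σ : Equiv.Perm (Fin n)) {m : ℕ} (h : m < n) :
    prefixSet σ (m + 1) = insert (σ ⟨m, h⟩) (prefixSet σ m) := by
  rw [prefixSet, prefixSet, ← Equiv.coe_toEmbedding, ← Finset.map_insert]
  congr 1
  ext i
  simp only [Finset.mem_filter, Finset.mem_univ, true_and, Finset.mem_insert, Fin.ext_iff]
  omega

lemma prefixSet_mul {n : ℕ} (τ σ : Equiv.Perm (Fin n)) (m : ℕ) :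
    prefixSet (τ * σ) m = (prefixSet σ m).map τ.toEmbedding := by
  rw [prefixSet, prefixSet, Finset.map_map]
  rfl

/-- The number of permutations that preserve the set of the first `m` elements of `Fin n`. -/
def prefixStabilizerCard (n m : ℕ) : ℕ :=
  (Finset.univ.filter fun σ : Equiv.Perm (Fin n) ↦ prefixSet σ m = prefixSet 1 m).card

lemma prefixStabilizerCard_pos (n m : ℕ) : 0 < prefixStabilizerCard n m :=
  Finset.card_pos.2 ⟨1, by simp⟩

lemma exists_prefixSet_eq {n : ℕ} (A : Finset (Fin n)) :
    ∃ τ : Equiv.Perm (Fin n), prefixSet τ A.card = A := by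
  have hA : A.card ≤ n := by simpa using A.card_le_univ
  let e : {i : Fin n // i.val < A.card} ≃ {i : Fin n // i ∈ A} :=
    Fintype.equivOfCardEq (by
      rw [Fintype.card_subtype, Fin.card_filter_val_lt, min_eq_right hA, Fintype.card_coe])
  refine ⟨e.extendSubtype, Finset.eq_of_subset_of_card_le ?_ (card_prefixSet _ hA).ge⟩
  intro x hx
  simp only [prefixSet, Finset.mem_map, Finset.mem_filter, Finset.mem_univ, true_and] at hx
  obtain ⟨i, hi, rfl⟩ := hx
  exact e.extendSubtype_mem i hi

/-- The permutations carrying the first |A| elements onto `A` form a coset of the stabilizer, so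
their number depends only on |A|. -/
lemma card_prefixSet_eq {n : ℕ} (A : Finset (Fin n)) :
    (Finset.univ.filter fun σ : Equiv.Perm (Fin n) ↦ prefixSet σ A.card = A).card =
      prefixStabilizerCard n A.card := by
  obtain ⟨τ, hτ⟩ := exists_prefixSet_eq A
  symm
  refine Finset.card_equiv (Equiv.mulLeft τ) fun σ ↦ ?_
  have h : prefixSet τ A.card = (prefixSet 1 A.card).map τ.toEmbedding := by
    rw [← prefixSet_mul, mul_one]
  simp only [Finset.mem_filter, Finset.mem_univ, true_and, Equiv.coe_mulLeft, prefixSet_mul]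
  conv_rhs => rw [← hτ, card_prefixSet τ (by simpa using A.card_le_univ), h]
  exact (Finset.map_injective _).eq_iff.symm

/-- A sum over all subsets of `Fin n` as a weighted sum over all initial segments of all
orderings. -/
lemma sum_finset_eq_sum_perm (K : Type*) [Field K] [CharZero K] {V : Type*} [AddCommGroup V]
    [Module K V] {n : ℕ} (φ : Finset (Fin n) → V) :
    ∑ A, φ A = ∑ σ : Equiv.Perm (Fin n), ∑ m ∈ Finset.range (n + 1),
      (prefixStabilizerCard n m : K)⁻¹ • φ (prefixSet σ m) := by
  -- Only `m = A.card` contributes; there the weight cancels the number of orderings that begin with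
  -- `A`.
  have key : ∀ A, φ A = ∑ σ : Equiv.Perm (Fin n), ∑ m ∈ Finset.range (n + 1),
      if prefixSet σ m = A then (prefixStabilizerCard n m : K)⁻¹ • φ A else 0 := by
    intro A
    have hA : A.card ≤ n := by simpa using A.card_le_univ
    rw [Finset.sum_comm, Finset.sum_eq_single A.card]
    · rw [← Finset.sum_filter, Finset.sum_const, card_prefixSet_eq, ← Nat.cast_smul_eq_nsmul K,
        smul_smul, mul_inv_cancel₀ (by exact_mod_cast (prefixStabilizerCard_pos n A.card).ne'),
        one_smul]
    · intro m hm hmA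
      refine Finset.sum_eq_zero fun σ _ ↦ if_neg ?_
      rintro rfl
      exact hmA (card_prefixSet σ (Nat.lt_succ_iff.1 (Finset.mem_range.1 hm))).symm
    · intro h
      exact absurd (Finset.mem_range.2 (Nat.lt_succ_iff.2 hA)) h
  rw [Finset.sum_congr rfl fun A _ ↦ key A, Finset.sum_comm]
  refine Finset.sum_congr rfl fun σ _ ↦ ?_
  rw [Finset.sum_comm]
  refine Finset.sum_congr rfl fun m _ ↦ ?_
  rw [Finset.sum_ite_eq, if_pos (Finset.mem_univ _)]

/-! ### Rank sequences and the Tutte polynomial -/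

/-- The rank sequence of `M` in the ordering `f ∘ σ`: its entries are the rank increments along
the chain of initial segments. -/
noncomputable def rankSequence {α : Type*} {n : ℕ} (M : Matroid α) (f : Fin n → α)
    (σ : Equiv.Perm (Fin n)) (i : Fin n) : Fin 2 :=
  if pulledRank M f (prefixSet σ (i + 1)) = pulledRank M f (prefixSet σ i) then 0 else 1

/-- Adding one element raises the rank by 0 or 1, so the entries are the true increments and their
sum telescopes. -/
lemma onesBelow_rankSequence {α : Type*} {n : ℕ} (M : Matroid α) (f : Fin n → α)
    (σ : Equiv.Perm (Fin n)) {m : ℕ} (hm : m ≤ n) :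
    onesBelow (rankSequence M f σ) m = pulledRank M f (prefixSet σ m) := by
  induction m with
  | zero => rw [onesBelow_zero, prefixSet_zero, pulledRank_empty]
  | succ m ih =>
    have h1 := pulledRank_insert_le M f (σ ⟨m, hm⟩) (prefixSet σ m)
    have h2 := pulledRank_mono M f (Finset.subset_insert (σ ⟨m, hm⟩) (prefixSet σ m))
    rw [← prefixSet_succ] at h1 h2
    rw [onesBelow_succ _ hm, ih (by omega)]
    by_cases h : pulledRank M f (prefixSet σ (m + 1)) = pulledRank M f (prefixSet σ m)
    · simp [rankSequence, h]
    · simp only [rankSequence, h, if_false, if_true]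
      omega

/-- The contribution to the Tutte polynomial of an ordering with rank sequence `s`. -/
noncomputable def sequenceTutte (K : Type*) [Field K] {n : ℕ} (s : Fin n → Fin 2) :
    MvPolynomial (Fin 2) K :=
  ∑ m ∈ Finset.range (n + 1), (prefixStabilizerCard n m : K)⁻¹ •
    ((MvPolynomial.X 0 - 1) ^ (onesBelow s n - onesBelow s m) *
      (MvPolynomial.X 1 - 1) ^ (m - onesBelow s m))

lemma tuttePolynomial_eq_sum_pulledRank (K : Type*) [CommRing K] {α : Type*} {n : ℕ}
    (M : Matroid α) [M.Finite] {f : Fin n → α} (hf : f.Injective) (hE : Set.range f = M.E) :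
    tuttePolynomial K M = ∑ A : Finset (Fin n),
      (MvPolynomial.X 0 - 1) ^ (pulledRank M f Finset.univ - pulledRank M f A) *
        (MvPolynomial.X 1 - 1) ^ (A.card - pulledRank M f A) := by
  unfold tuttePolynomial
  symm
  refine Finset.sum_bij (fun A _ ↦ A.map ⟨f, hf⟩) ?_ ?_ ?_ ?_
  · intro A _
    rw [Finset.mem_powerset]
    intro x hx
    rw [Set.Finite.mem_toFinset, ← hE]
    obtain ⟨i, -, rfl⟩ := Finset.mem_map.1 hx
    exact ⟨i, rfl⟩
  · intro A _ B _ h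
    exact Finset.map_injective _ h
  · intro B hB
    refine ⟨B.preimage f hf.injOn, Finset.mem_univ _, ?_⟩
    ext x
    simp only [Finset.mem_map, Finset.mem_preimage, Function.Embedding.coeFn_mk]
    constructor
    · rintro ⟨i, hi, rfl⟩
      exact hi
    · intro hx
      have h1 := Finset.mem_powerset.1 hB hx
      rw [Set.Finite.mem_toFinset, ← hE] at h1
      obtain ⟨i, rfl⟩ := h1
      exact ⟨i, hx, rfl⟩
  · intro A _
    simp only [pulledRank, Finset.card_map, Finset.coe_map, Function.Embedding.coeFn_mk,
      Finset.coe_univ, Set.image_univ, hE]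

lemma tuttePolynomial_eq_sum_rankSequence (K : Type*) [Field K] [CharZero K] {α : Type*} {n : ℕ}
    (M : Matroid α) [M.Finite] {f : Fin n → α} (hf : f.Injective) (hE : Set.range f = M.E) :
    tuttePolynomial K M =
      ∑ σ : Equiv.Perm (Fin n), sequenceTutte K (rankSequence M f σ) := by
  rw [tuttePolynomial_eq_sum_pulledRank K M hf hE, sum_finset_eq_sum_perm K]
  refine Finset.sum_congr rfl fun σ _ ↦ Finset.sum_congr rfl fun m hm ↦ ?_
  have hm' : m ≤ n := Nat.lt_succ_iff.1 (Finset.mem_range.1 hm)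
  rw [onesBelow_rankSequence M f σ hm', onesBelow_rankSequence M f σ le_rfl, prefixSet_length,
    card_prefixSet σ hm']

lemma tuttePolynomial_freedomMatroid (K : Type*) [Field K] [CharZero K] {n : ℕ}
    (s : Fin n → Fin 2) :
    tuttePolynomial K (freedomMatroid s) =
      ∑ σ : Equiv.Perm (Fin n), sequenceTutte K (rankSequence (freedomMatroid s) id σ) :=
  tuttePolynomial_eq_sum_rankSequence K _ Function.injective_id (by
    rw [Set.range_id, freedomMatroid_ground])

/-! ### Dominance and triangular inversion -/

lemma onesBelow_le_onesBelow_rankSequence {n : ℕ} (s : Fin n → Fin 2) (σ : Equiv.Perm (Fin n))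
    {m : ℕ} (hm : m ≤ n) :
    onesBelow s m ≤ onesBelow (rankSequence (freedomMatroid s) id σ) m := by
  have h := onesBelow_card_le_pulledRank s (prefixSet σ m)
  rwa [card_prefixSet σ hm, ← onesBelow_rankSequence _ _ _ hm] at h

lemma onesBelow_rankSequence_freedomMatroid {n : ℕ} (s : Fin n → Fin 2)
    (σ : Equiv.Perm (Fin n)) :
    onesBelow (rankSequence (freedomMatroid s) id σ) n = onesBelow s n := by
  refine le_antisymm ?_ (onesBelow_le_onesBelow_rankSequence s σ le_rfl)
  rw [onesBelow_rankSequence _ _ _ le_rfl]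
  exact pulledRank_freedomMatroid_le s le_rfl fun i _ ↦ i.isLt

/-- In the natural order the lower and upper rank bounds meet; this makes the diagonal coefficient
nonzero. -/
lemma rankSequence_freedomMatroid_one {n : ℕ} (s : Fin n → Fin 2) :
    rankSequence (freedomMatroid s) id 1 = s := by
  refine onesBelow_injective fun m hm ↦
    le_antisymm ?_ (onesBelow_le_onesBelow_rankSequence s 1 hm)
  rw [onesBelow_rankSequence _ _ _ hm]
  refine pulledRank_freedomMatroid_le s hm fun i hi ↦ ?_
  obtain ⟨j, hj, rfl⟩ := Finset.mem_map.1 hi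
  exact (Finset.mem_filter.1 hj).2

/-- The matrix that expresses the Tutte polynomials of freedom matroids through contributions of
sequences is triangular with respect to dominance, so it can be inverted. -/
lemma sequenceTutte_mem_span (K : Type*) [Field K] [CharZero K] {n : ℕ} (s : Fin n → Fin 2) :
    sequenceTutte K s ∈ Submodule.span K
      ((fun t ↦ tuttePolynomial K (freedomMatroid t)) ''
        {t : Fin n → Fin 2 | onesBelow t n = onesBelow s n}) := by
  -- Each of the `n + 1` counts is at most `n`. The gap to this bound is the induction measure, and
  -- it shrinks as a sequence moves up in dominance.
  have hbound : ∀ t : Fin n → Fin 2,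
      ∑ m ∈ Finset.range (n + 1), onesBelow t m ≤ (n + 1) * n := by
    intro t
    refine (Finset.sum_le_card_nsmul _ _ n fun m _ ↦ ?_).trans (by simp)
    exact (Finset.card_le_univ _).trans (by simp)
  induction hd : (n + 1) * n - ∑ m ∈ Finset.range (n + 1), onesBelow s m
    using Nat.strong_induction_on generalizing s with
  | _ d ih =>
    let S := Submodule.span K ((fun t ↦ tuttePolynomial K (freedomMatroid t)) ''
        {t : Fin n → Fin 2 | onesBelow t n = onesBelow s n})
    change sequenceTutte K s ∈ S
    have hT : tuttePolynomial K (freedomMatroid s) ∈ S := Submodule.subset_span ⟨s, rfl, rfl⟩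
    have hrest : ∀ σ : Equiv.Perm (Fin n), rankSequence (freedomMatroid s) id σ ≠ s →
        sequenceTutte K (rankSequence (freedomMatroid s) id σ) ∈ S := by
      intro σ hσ
      have hlt : ∑ m ∈ Finset.range (n + 1), onesBelow s m <
          ∑ m ∈ Finset.range (n + 1), onesBelow (rankSequence (freedomMatroid s) id σ) m := by
        refine Finset.sum_lt_sum (fun m hm ↦ onesBelow_le_onesBelow_rankSequence s σ
          (Nat.lt_succ_iff.1 (Finset.mem_range.1 hm))) ?_
        by_contra! hge
        exact hσ (onesBelow_injective fun m hm ↦ le_antisymm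
          (hge m (Finset.mem_range.2 (Nat.lt_succ_iff.2 hm)))
          (onesBelow_le_onesBelow_rankSequence s σ hm))
      have hb := hbound (rankSequence (freedomMatroid s) id σ)
      have h := ih _ (by omega) (rankSequence (freedomMatroid s) id σ) rfl
      rwa [onesBelow_rankSequence_freedomMatroid] at h
    -- Separate the diagonal, where the rank sequence is `s`, from the strictly dominating sequences
    -- already known to lie in `S`.
    rw [tuttePolynomial_freedomMatroid, ← Finset.sum_filter_add_sum_filter_not Finset.univ
      (fun σ ↦ rankSequence (freedomMatroid s) id σ = s)] at hT
    have hmem := (Submodule.add_mem_iff_left S (Submodule.sum_mem S fun σ hσ ↦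
      hrest σ (Finset.mem_filter.1 hσ).2)).1 hT
    rw [Finset.sum_congr rfl fun σ hσ ↦ congrArg (sequenceTutte K) (Finset.mem_filter.1 hσ).2,
      Finset.sum_const, ← Nat.cast_smul_eq_nsmul K] at hmem
    refine (Submodule.smul_mem_iff S ?_).1 hmem
    rw [Nat.cast_ne_zero, ← Nat.pos_iff_ne_zero, Finset.card_pos]
    exact ⟨1, by simp [rankSequence_freedomMatroid_one]⟩

theorem corollary1p10 (K : Type*) [Field K] [CharZero K] (n r : ℕ)
    {α : Type*} (M : Matroid α) [M.Finite] (hn : M.E.ncard = n) (hr : M.eRank = r) :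
    ∃ c : (Fin n → Fin 2) → K,
      tuttePolynomial K M =
        ∑ s : Fin n → Fin 2 with (Finset.univ.filter (fun i ↦ s i = 1)).card = r,
          c s • tuttePolynomial K (freedomMatroid s) := by
  obtain ⟨f, hf, hE⟩ : ∃ f : Fin n → α, f.Injective ∧ Set.range f = M.E := by
    have : Finite M.E := M.ground_finite
    let e : Fin n ≃ M.E := (Finite.equivFinOfCardEq hn).symm
    exact ⟨fun i ↦ (e i : α), Subtype.val_injective.comp e.injective, by
      rw [← Function.comp_def, Set.range_comp, e.range_eq_univ, Set.image_univ,
        Subtype.range_coe]⟩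
  have hmem : tuttePolynomial K M ∈ Submodule.span K
      ((fun s ↦ tuttePolynomial K (freedomMatroid s)) ''
        ((Finset.univ.filter fun s : Fin n → Fin 2 ↦
          (Finset.univ.filter (fun i ↦ s i = 1)).card = r : Finset (Fin n → Fin 2)) :
            Set (Fin n → Fin 2))) := by
    rw [tuttePolynomial_eq_sum_rankSequence K M hf hE]
    refine Submodule.sum_mem _ fun σ _ ↦ ?_
    -- The last initial segment is the whole ground set, so every rank sequence of `M` has `r` ones.
    have hσ : onesBelow (rankSequence M f σ) n = r := by
      rw [onesBelow_rankSequence M f σ le_rfl, prefixSet_length, pulledRank, Finset.coe_univ,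
        Set.image_univ, hE, Matroid.eRk_ground, hr, ENat.toNat_natCast]
    have h := sequenceTutte_mem_span K (rankSequence M f σ)
    simpa only [hσ, onesBelow_length, Finset.coe_filter, Finset.mem_univ, true_and] using h
  obtain ⟨c, hc⟩ := (Submodule.mem_span_image_finset_iff_exists_fun' K).1 hmem
  exact ⟨c, hc.symm⟩
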